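/- Let $M$ be a compact complex manifold of dimension $k$ with a (smooth) Hermitian metric $ds_M^2$. Write $E_M(p,v)=\big(ds_M^2(v,\bar v)\big)^{1/2}$ for the length of a tangent vector $v$ at $p\in M$, and $d_M$ for the induced distance (the infimum of the $E_M$-lengths of curves). Let $\varphi:[0,\infty)\to(0,\infty)$ be a function such that, with $$\gamma_r:=\sup_{r\le a<b}\left|\frac{\varphi(a)-\varphi(b)}{a-b}\right|,$$ there is a constant $C\in(0,1]$ with $\gamma_r\le C$ for all $r\in(0,\infty)$, and $\lim_{r\to\infty}\gamma_r=0$. A holomorphic map $f:\mathbb{C}^m\to M$ is called a weighted Yosida mapping (with weight $\varphi$) if $$\limsup_{\|z\|\to\infty,\ \|\xi\|=1}\varphi(\|z\|)\,E_M\big(f(z),df(z)(\xi)\big)<\infty ,$$ where $z,\xi\in\mathbb{C}^m$, $\|\cdot\|$ is the Euclidean norm and $df(z):T_z\mathbb{C}^m\to T_{f(z)}M$ is the differential of $f$. Let $f:\mathbb{C}^m\to M$ be holomorphic. Then $f$ is not a weighted Yosida mapping if and only if there exist sequences $(z_j)$, $(\xi_j)$ in $\mathbb{C}^m$ and $(\rho_j)$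 in $(0,1)$ with $\|z_j\|\to\infty$, $\|\xi_j\|=1$ for all $j$, and $\rho_j\to0$, such that the sequence of maps $$g_j:\mathbb{C}\to M,\qquad g_j(\zeta)=f\big(z_j+\rho_j\,\varphi(\|z_j\|)\,\xi_j\,\zeta\big),$$ converges, uniformly (with respect to $d_M$) on every compact subset of $\mathbb{C}$, to a non-constant holomorphic map $g:\mathbb{C}\to M$. -/

import Mathlib

open Filter Topology Manifold Bundle
open scoped ENNReal ContDiff

noncomputable section

/-- Complex affine space `ℂⁿ` with its Euclidean norm. -/
abbrev CSpace (n : ℕ) : Type := EuclideanSpace ℂ (Fin n)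

/-- A complex manifold of dimension `k` is a real-analytic manifold modelled on `ℂᵏ = ℝ²ᵏ`. -/
instance instIsManifoldRealOfComplex {k : ℕ} {M : Type*} [TopologicalSpace M]
    [ChartedSpace (CSpace k) M] [IsManifold 𝓘(ℂ, CSpace k) ω M] :
    IsManifold 𝓘(ℝ, CSpace k) ω M := by
  refine isManifold_of_contDiffOn 𝓘(ℝ, CSpace k) ω M fun e e' he he' ↦ ?_
  have h := (mem_groupoid_of_pregroupoid.1 (HasGroupoid.compatible
    (G := contDiffGroupoid ω 𝓘(ℂ, CSpace k)) he he')).1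
  exact ContDiffOn.restrict_scalars ℝ h

/-- The complex structure `J` on the (real) tangent space of a complex manifold: multiplication by
the imaginary unit in the holomorphic coordinates given by the preferred chart at the point (the
coordinates in which Mathlib represents tangent vectors). -/
def complexStructure {k : ℕ} {M : Type*} [TopologicalSpace M] [ChartedSpace (CSpace k) M]
    (p : M) (v : TangentSpace 𝓘(ℝ, CSpace k) p) : TangentSpace 𝓘(ℝ, CSpace k) p :=
  (Complex.I • (show CSpace k from v) : CSpace k)

/-- A Riemannian metric `⟨·,·⟩` on a complex manifold is Hermitian if `⟨J v, J w⟩ = ⟨v, w⟩`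
for all tangent vectors. It is then the real part of a unique Hermitian form `h` on the complex
tangent spaces, linear in one variable and conjugate-linear in the other, with
`h(v, v) = ⟨v, v⟩`; conversely the real part of a Hermitian metric is such a metric. -/
class IsHermitianMetric (k : ℕ) (M : Type*) [TopologicalSpace M] [ChartedSpace (CSpace k) M]
    [RiemannianBundle (fun p : M ↦ TangentSpace 𝓘(ℝ, CSpace k) p)] : Prop where
  inner_complexStructure : ∀ (p : M) (v w : TangentSpace 𝓘(ℝ, CSpace k) p),
    inner ℝ (complexStructure p v) (complexStructure p w) = inner ℝ v w

/-- The length `E_M(p, v) = h_p(v, v)^{1/2}` of a tangent vector `v` at `p`, that is, its norm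
in the given metric. -/
def hermitianLength {k : ℕ} {M : Type*} [TopologicalSpace M] [ChartedSpace (CSpace k) M]
    [RiemannianBundle (fun p : M ↦ TangentSpace 𝓘(ℝ, CSpace k) p)]
    (p : M) (v : TangentSpace 𝓘(ℝ, CSpace k) p) : ℝ :=
  ‖v‖

/-- `γ_r = sup { |(φ(a) - φ(b)) / (a - b)| : r ≤ a < b }`, as an element of `[0, ∞]`. -/
def slopeSup (φ : ℝ → ℝ) (r : ℝ) : ℝ≥0∞ :=
  ⨆ (a : ℝ) (b : ℝ) (_ : r ≤ a ∧ a < b), ENNReal.ofReal |(φ a - φ b) / (a - b)|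

/-- The admissible weights `φ : [0, ∞) → (0, ∞)`. Values of `φ` at negative reals are irrelevant. -/
structure IsYosidaWeight (φ : ℝ → ℝ) : Prop where
  pos : ∀ r, 0 ≤ r → 0 < φ r
  slopeSup_le : ∃ C : ℝ, 0 < C ∧ C ≤ 1 ∧ ∀ r, 0 < r → slopeSup φ r ≤ ENNReal.ofReal C
  tendsto_slopeSup : Tendsto (slopeSup φ) atTop (𝓝 0)

/-- `f : ℂᵐ → M` is a weighted Yosida mapping: `f` is holomorphic and
`limsup_{‖z‖ → ∞, ‖ξ‖ = 1} φ(‖z‖) E_M(f(z), df(z)(ξ)) < ∞`, the differential `df(z)` being the real differential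
`T_z ℂᵐ → T_{f(z)} M`. -/
def IsWeightedYosida {m k : ℕ} {M : Type*} [TopologicalSpace M] [ChartedSpace (CSpace k) M]
    [RiemannianBundle (fun p : M ↦ TangentSpace 𝓘(ℝ, CSpace k) p)]
    (φ : ℝ → ℝ) (f : CSpace m → M) : Prop :=
  MDifferentiable 𝓘(ℂ, CSpace m) 𝓘(ℂ, CSpace k) f ∧
    limsup (fun x : CSpace m × CSpace m ↦ ENNReal.ofReal
        (φ ‖x.1‖ * hermitianLength (k := k) (f x.1)
          (mfderiv 𝓘(ℝ, CSpace m) 𝓘(ℝ, CSpace k) f x.1 x.2)))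
      (comap (fun x : CSpace m × CSpace m ↦ ‖x.1‖) atTop ⊓ 𝓟 {x | ‖x.2‖ = 1}) < ⊤

end

/-! This is a Zalcman–Brody rescaling argument. The weight is 1-Lipschitz on positive radii, so it
changes by at most a quarter of its value on a ball of radius `φ ‖z‖ / 4` about a far point `z`. If
`f` is not Yosida, Hofer's lemma for the dilation `F`
(`exists_dilation_le_two_mul_of_not_isWeightedYosida`) yields `z n` with `φ ‖z n‖ * F (z n)` large
and `F ≤ 2 * F (z n)` on a ball of radius at least `n / F (z n)`. With `ρ n = (φ ‖z n‖ * F (z n))⁻¹`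
the rescaled maps are 2-Lipschitz on the disc of radius `n`, so Arzelà–Ascoli gives a convergent
subsequence. Weierstrass's theorem in a chart makes the limit holomorphic and carries the unit
length of the differentials at 0 to the limit, which is therefore not constant. Conversely, for a
Yosida map the rescaled image of a segment from 0 to `ζ` has length `O(ρ j * ‖ζ‖)`, so every limit
is constant. -/

/-! ### Regularity and limits of holomorphic maps. -/

theorem contDiffOn_one_of_differentiableOn_complex
    {E F : Type*} [NormedAddCommGroup E] [NormedSpace ℂ E] [FiniteDimensional ℂ E]
    [NormedAddCommGroup F] [NormedSpace ℂ F] [CompleteSpace F]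
    {g : E → F} {U : Set E} (hg : DifferentiableOn ℂ g U) (hU : IsOpen U) :
    ContDiffOn ℂ 1 g U := by
  rw [show (1 : WithTop ℕ∞) = 0 + 1 by simp, contDiffOn_succ_iff_fderiv_of_isOpen hU]
  refine ⟨hg, by simp, contDiffOn_zero.2 <| continuousOn_clm_apply.2
    fun v x₀ hx₀ ↦ ContinuousAt.continuousWithinAt ?_⟩
  have hline : Continuous fun p : E × ℂ ↦ p.1 + p.2 • v := by fun_prop
  have hmem : ∀ᶠ p : E × ℂ in 𝓝 x₀ ×ˢ 𝓝 0, p.1 + p.2 • v ∈ U := by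
    rw [← nhds_prod_eq]
    exact hline.continuousAt.eventually_mem (hU.mem_nhds (by simpa using hx₀))
  obtain ⟨s, hs, t, ht, hst⟩ := Filter.eventually_prod_iff.1 hmem
  obtain ⟨T, hTt, hTo, h0T⟩ := eventually_nhds_iff.1 ht
  have hderiv : ∀ x ∈ U, fderiv ℂ g x v = deriv (fun t : ℂ ↦ g (x + t • v)) 0 := by
    intro x hx
    have h1 : HasFDerivAt g (fderiv ℂ g x) (x + (0 : ℂ) • v) := by
      simpa using (hg.differentiableAt (hU.mem_nhds hx)).hasFDerivAt
    have h2 : HasDerivAt (fun t : ℂ ↦ x + t • v) v 0 := by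
      simpa using ((hasDerivAt_id (0 : ℂ)).smul_const v).const_add x
    exact (h1.comp_hasDerivAt (0 : ℂ) h2).deriv.symm
  -- The slices of `g` in direction `v` converge locally uniformly as the base point tends to `x₀`;
  -- Weierstrass then gives convergence of their derivatives at 0, which are the directional
  -- derivatives.
  have hlim : TendstoLocallyUniformlyOn (fun (x : E) (t : ℂ) ↦ g (x + t • v))
      (fun t ↦ g (x₀ + t • v)) (𝓝 x₀) T := by
    rw [tendstoLocallyUniformlyOn_iff_forall_tendsto]
    intro t₀ ht₀
    have hU₀ : x₀ + t₀ • v ∈ U := hst hs.self_of_nhds (hTt _ ht₀)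
    have hc : ContinuousAt g (x₀ + t₀ • v) := hg.continuousOn.continuousAt (hU.mem_nhds hU₀)
    have h1 : Tendsto (fun p : E × ℂ ↦ g (p.1 + p.2 • v)) (𝓝 x₀ ×ˢ 𝓝[T] t₀)
        (𝓝 (g (x₀ + t₀ • v))) := by
      refine Tendsto.mono_left ?_ (Filter.prod_mono_right _ nhdsWithin_le_nhds)
      rw [← nhds_prod_eq]
      exact ContinuousAt.comp (f := fun p : E × ℂ ↦ p.1 + p.2 • v) (x := (x₀, t₀)) hc
        hline.continuousAt
    have h2 : Tendsto (fun p : E × ℂ ↦ g (x₀ + p.2 • v)) (𝓝 x₀ ×ˢ 𝓝[T] t₀)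
        (𝓝 (g (x₀ + t₀ • v))) := by
      have : Tendsto (fun p : E × ℂ ↦ (x₀, p.2)) (𝓝 x₀ ×ˢ 𝓝[T] t₀) (𝓝 x₀ ×ˢ 𝓝[T] t₀) :=
        Tendsto.prodMk (tendsto_nhds_of_eventually_eq (by simp)) tendsto_snd
      exact h1.comp this
    exact (h2.prodMk_nhds h1).mono_right (nhds_le_uniformity _)
  have hdiff : ∀ᶠ x in 𝓝 x₀, DifferentiableOn ℂ (fun t : ℂ ↦ g (x + t • v)) T := by
    filter_upwards [hs] with x hx t ht
    have : DifferentiableAt ℂ g (x + t • v) := hg.differentiableAt (hU.mem_nhds (hst hx (hTt _ ht)))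
    refine (DifferentiableAt.comp t this ?_).differentiableWithinAt
    fun_prop
  have hT := ((hlim.deriv hdiff hTo).tendsto_at h0T)
  rw [ContinuousAt, hderiv x₀ hx₀]
  refine hT.congr' ?_
  filter_upwards [hU.mem_nhds hx₀] with x hx
  exact (hderiv x hx).symm

section Manifold

variable {k : ℕ} {M : Type*} [TopologicalSpace M] [ChartedSpace (CSpace k) M]
  {E : Type*} [NormedAddCommGroup E] [NormedSpace ℂ E]

theorem MDifferentiable.differentiableOn_extChartAt_comp [IsManifold 𝓘(ℂ, CSpace k) ω M]
    {f : E → M} (hf : MDifferentiable 𝓘(ℂ, E) 𝓘(ℂ, CSpace k) f) (p : M) :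
    DifferentiableOn ℂ (extChartAt 𝓘(ℂ, CSpace k) p ∘ f)
      (f ⁻¹' (chartAt (CSpace k) p).source) := by
  intro x hx
  have h : MDifferentiableAt 𝓘(ℂ, CSpace k) 𝓘(ℂ, CSpace k) (extChartAt 𝓘(ℂ, CSpace k) p) (f x) :=
    mdifferentiableAt_extChartAt hx
  exact (h.comp x (hf x)).differentiableAt.differentiableWithinAt

theorem MDifferentiable.contMDiff_one_restrictScalars [IsManifold 𝓘(ℂ, CSpace k) ω M]
    [FiniteDimensional ℂ E]
    {f : E → M} (hf : MDifferentiable 𝓘(ℂ, E) 𝓘(ℂ, CSpace k) f) :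
    ContMDiff 𝓘(ℝ, E) 𝓘(ℝ, CSpace k) 1 f := by
  intro x
  rw [contMDiffAt_iff_target]
  refine ⟨hf.continuous.continuousAt, ContDiffAt.contMDiffAt ?_⟩
  have hU : IsOpen (f ⁻¹' (chartAt (CSpace k) (f x)).source) :=
    (chartAt (CSpace k) (f x)).open_source.preimage hf.continuous
  have h := contDiffOn_one_of_differentiableOn_complex (hf.differentiableOn_extChartAt_comp (f x)) hU
  exact (h.contDiffAt (hU.mem_nhds (mem_chart_source _ _))).restrict_scalars ℝ

/-- Near `ζ₀` the late maps and the limit take values in a single chart domain, where Weierstrass's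
theorem applies. The convergence of derivatives is what later detects non-constancy. -/
theorem mdifferentiable_and_tendsto_deriv_of_tendstoUniformlyOn {M : Type*} [UniformSpace M]
    [ChartedSpace (CSpace k) M] [IsManifold 𝓘(ℂ, CSpace k) ω M]
    {g : ℕ → ℂ → M} {g₀ : ℂ → M} (hg : ∀ n, MDifferentiable 𝓘(ℂ, ℂ) 𝓘(ℂ, CSpace k) (g n))
    (hlim : ∀ K : Set ℂ, IsCompact K → TendstoUniformlyOn g g₀ atTop K) (ζ₀ : ℂ) :
    MDifferentiableAt 𝓘(ℂ, ℂ) 𝓘(ℂ, CSpace k) g₀ ζ₀ ∧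
    Tendsto (fun n ↦ deriv (extChartAt 𝓘(ℂ, CSpace k) (g₀ ζ₀) ∘ g n) ζ₀) atTop
      (𝓝 (deriv (extChartAt 𝓘(ℂ, CSpace k) (g₀ ζ₀) ∘ g₀) ζ₀)) := by
  have hloc : TendstoLocallyUniformly g g₀ atTop :=
    tendstoLocallyUniformly_iff_forall_isCompact.2 hlim
  have hcont : Continuous g₀ := hloc.continuous (.of_forall fun n ↦ (hg n).continuous)
  set e := extChartAt 𝓘(ℂ, CSpace k) (g₀ ζ₀)
  set S := (chartAt (CSpace k) (g₀ ζ₀)).source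
  have hSo : IsOpen S := (chartAt (CSpace k) (g₀ ζ₀)).open_source
  have hev : ∀ ζ, Tendsto (fun q : ℕ × ℂ ↦ g q.1 q.2) (atTop ×ˢ 𝓝 ζ) (𝓝 (g₀ ζ)) := fun ζ ↦
    ((hcont.tendsto ζ).comp tendsto_snd).congr_uniformity
      (tendstoLocallyUniformly_iff_forall_tendsto.1 hloc ζ)
  have hmem : ∀ᶠ q : ℕ × ℂ in atTop ×ˢ 𝓝 ζ₀, g q.1 q.2 ∈ S :=
    (hev ζ₀).eventually_mem (hSo.mem_nhds (mem_chart_source _ _))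
  obtain ⟨s, hs, t, ht, hst⟩ := Filter.eventually_prod_iff.1 hmem
  obtain ⟨T₀, hT₀t, hT₀o, h0T₀⟩ := eventually_nhds_iff.1 ht
  set T := T₀ ∩ g₀ ⁻¹' S
  have hTo : IsOpen T := hT₀o.inter (hSo.preimage hcont)
  have h0T : ζ₀ ∈ T := ⟨h0T₀, mem_chart_source _ _⟩
  have hunif : TendstoLocallyUniformlyOn (fun n ↦ e ∘ g n) (e ∘ g₀) atTop T := by
    rw [tendstoLocallyUniformlyOn_iff_forall_tendsto]
    intro ζ hζ
    have he : ContinuousAt e (g₀ ζ) := continuousAt_extChartAt' (by simpa using hζ.2)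
    have hle : atTop ×ˢ 𝓝[T] ζ ≤ (atTop ×ˢ 𝓝 ζ : Filter (ℕ × ℂ)) :=
      Filter.prod_mono_right _ nhdsWithin_le_nhds
    have h1 := (he.tendsto.comp (hev ζ)).mono_left hle
    have h2 := (he.tendsto.comp ((hcont.tendsto ζ).comp
      (tendsto_snd (f := (atTop : Filter ℕ))))).mono_left hle
    exact (h2.prodMk_nhds h1).mono_right (nhds_le_uniformity _)
  have hdiff : ∀ᶠ n in atTop, DifferentiableOn ℂ (e ∘ g n) T := by
    filter_upwards [hs] with n hn
    exact ((hg n).differentiableOn_extChartAt_comp (g₀ ζ₀)).mono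
      fun ζ hζ ↦ hst hn (hT₀t _ hζ.1)
  refine ⟨?_, (hunif.deriv hdiff hTo).tendsto_at h0T⟩
  rw [mdifferentiableAt_iff_target]
  exact ⟨hcont.continuousAt, ((hunif.differentiableOn hdiff hTo).differentiableAt
    (hTo.mem_nhds h0T)).mdifferentiableAt⟩

end Manifold

/-! ### Lipschitz and growth bounds for the weight. -/

section Weight

theorem IsYosidaWeight.abs_sub_le {φ : ℝ → ℝ} (hφ : IsYosidaWeight φ) {a b : ℝ} (ha : 0 < a)
    (hb : 0 < b) : |φ a - φ b| ≤ |a - b| := by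
  wlog hab : a < b generalizing a b
  · rcases (not_lt.1 hab).eq_or_lt with rfl | h
    · simp
    · rw [abs_sub_comm, abs_sub_comm a]
      exact this hb ha h
  obtain ⟨C, hC, hC1, h⟩ := hφ.slopeSup_le
  have h1 : ENNReal.ofReal |(φ a - φ b) / (a - b)| ≤ slopeSup φ a :=
    le_iSup₂_of_le a b (le_iSup_of_le ⟨le_rfl, hab⟩ le_rfl)
  have h2 : |(φ a - φ b) / (a - b)| ≤ 1 :=
    ((ENNReal.ofReal_le_ofReal_iff hC.le).1 (h1.trans (h a ha))).trans hC1
  rw [abs_div, div_le_one (abs_pos.2 (sub_ne_zero.2 hab.ne))] at h2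
  exact h2

theorem IsYosidaWeight.le_add {φ : ℝ → ℝ} (hφ : IsYosidaWeight φ) {r : ℝ} (hr : 1 ≤ r) :
    φ r ≤ φ 1 + r := by
  have h1 := (le_abs_self _).trans (hφ.abs_sub_le (zero_lt_one.trans_le hr) zero_lt_one)
  rw [abs_of_nonneg (by linarith)] at h1
  linarith

end Weight

/-! ### Lengths of images and the dilation. -/

section Length

variable {k : ℕ} {M : Type*} [EMetricSpace M]
  [ChartedSpace (CSpace k) M]
  [RiemannianBundle (fun p : M ↦ TangentSpace 𝓘(ℝ, CSpace k) p)]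
  {E : Type*} [NormedAddCommGroup E] [NormedSpace ℝ E]

/-- The image of the segment from `a` to `b` is a competitor in the infimum that defines the
distance. -/
theorem edist_le_of_norm_mfderiv_le [IsRiemannianManifold 𝓘(ℝ, CSpace k) M] {f : E → M}
    (hf : ContMDiff 𝓘(ℝ, E) 𝓘(ℝ, CSpace k) 1 f) {s : Set E} (hs : Convex ℝ s) {C : ℝ}
    (hC : ∀ x ∈ s, ∀ v : E, ‖mfderiv 𝓘(ℝ, E) 𝓘(ℝ, CSpace k) f x v‖ ≤ C * ‖v‖) {a b : E}
    (ha : a ∈ s) (hb : b ∈ s) : edist (f a) (f b) ≤ ENNReal.ofReal (C * ‖b - a‖) := by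
  have hγ : ContMDiff 𝓘(ℝ, ℝ) 𝓘(ℝ, E) 1 (fun t : ℝ ↦ AffineMap.lineMap a b t) := by
    rw [contMDiff_iff_contDiff]
    exact (ContinuousAffineMap.lineMap (R := ℝ) a b).contDiff
  rw [IsRiemannianManifold.out (I := 𝓘(ℝ, CSpace k)) (f a) (f b)]
  refine (riemannianEDist_le_pathELength (γ := fun t : ℝ ↦ f (AffineMap.lineMap a b t))
    (hf.comp hγ).contMDiffOn (a := 0) (b := 1) (by simp) (by simp) zero_le_one).trans ?_
  rw [pathELength_eq_lintegral_mfderiv_Icc]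
  have hbound : ∀ t ∈ Set.Icc (0 : ℝ) 1,
      ‖mfderiv 𝓘(ℝ, ℝ) 𝓘(ℝ, CSpace k) (fun t : ℝ ↦ f (AffineMap.lineMap a b t)) t 1‖ₑ ≤
        ENNReal.ofReal (C * ‖b - a‖) := by
    intro t ht
    have h1 : HasMFDerivAt 𝓘(ℝ, ℝ) 𝓘(ℝ, E) (fun t : ℝ ↦ (AffineMap.lineMap a b t : E)) t
        (ContinuousLinearMap.toSpanSingleton ℝ (b - a)) :=
      (AffineMap.hasDerivAt_lineMap (a := a) (b := b) (x := t)).hasFDerivAt.hasMFDerivAt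
    have h2 := ((hf.mdifferentiable one_ne_zero (AffineMap.lineMap a b t)).hasMFDerivAt).comp t h1
    have h3 : mfderiv 𝓘(ℝ, ℝ) 𝓘(ℝ, CSpace k) (fun t : ℝ ↦ f (AffineMap.lineMap a b t)) t 1 =
        mfderiv 𝓘(ℝ, E) 𝓘(ℝ, CSpace k) f (AffineMap.lineMap a b t) (b - a) := by
      refine (DFunLike.congr_fun h2.mfderiv (1 : ℝ)).trans ?_
      exact congrArg (mfderiv 𝓘(ℝ, E) 𝓘(ℝ, CSpace k) f (AffineMap.lineMap a b t))
        (one_smul ℝ (b - a))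
    refine (congrArg (fun v : TangentSpace 𝓘(ℝ, CSpace k) (f (AffineMap.lineMap a b t)) ↦ ‖v‖ₑ)
      h3).trans_le ?_
    rw [← ofReal_norm]
    exact ENNReal.ofReal_le_ofReal (hC _ (hs.segment_subset ha hb
      (segment_eq_image_lineMap ℝ a b ▸ Set.mem_image_of_mem _ ht)) _)
  calc _ ≤ ∫⁻ t in Set.Icc (0 : ℝ) 1, ENNReal.ofReal (C * ‖b - a‖) :=
        MeasureTheory.setLIntegral_mono measurable_const hbound
    _ = _ := by simp

end Length

theorem IsContMDiffRiemannianBundle.isContinuousRiemannianBundle {k : ℕ} {M : Type*}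
    [TopologicalSpace M] [ChartedSpace (CSpace k) M] [IsManifold 𝓘(ℂ, CSpace k) ω M]
    [RiemannianBundle (fun p : M ↦ TangentSpace 𝓘(ℝ, CSpace k) p)] {n : WithTop ℕ∞}
    [h : IsContMDiffRiemannianBundle 𝓘(ℝ, CSpace k) n (CSpace k)
      (fun p : M ↦ TangentSpace 𝓘(ℝ, CSpace k) p)] :
    IsContinuousRiemannianBundle (CSpace k) (fun p : M ↦ TangentSpace 𝓘(ℝ, CSpace k) p) := by
  obtain ⟨g, hg, hg'⟩ := h.exists_contMDiff
  exact ⟨g, hg.continuous, hg'⟩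

section Dilation

variable {m k : ℕ} {M : Type*} [TopologicalSpace M]
  [ChartedSpace (CSpace k) M]
  [RiemannianBundle (fun p : M ↦ TangentSpace 𝓘(ℝ, CSpace k) p)]

/-- The largest length of `df(w)(ξ)` over unit vectors `ξ`. -/
noncomputable def dilation (f : CSpace m → M) (w : CSpace m) : ℝ :=
  sSup ((fun ξ : CSpace m ↦ hermitianLength (k := k) (f w)
    (mfderiv 𝓘(ℝ, CSpace m) 𝓘(ℝ, CSpace k) f w ξ)) '' Metric.sphere 0 1)

theorem dilation_nonneg (f : CSpace m → M) (w : CSpace m) : 0 ≤ dilation (k := k) f w := by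
  refine Real.sSup_nonneg ?_
  rintro _ ⟨ξ, -, rfl⟩
  exact norm_nonneg (E := TangentSpace 𝓘(ℝ, CSpace k) (f w)) _

theorem norm_mfderiv_le_of_unit {f : CSpace m → M} {w : CSpace m} {C : ℝ}
    (h : ∀ ξ : CSpace m, ‖ξ‖ = 1 → hermitianLength (k := k) (f w)
      (mfderiv 𝓘(ℝ, CSpace m) 𝓘(ℝ, CSpace k) f w ξ) ≤ C) (v : CSpace m) :
    ‖mfderiv 𝓘(ℝ, CSpace m) 𝓘(ℝ, CSpace k) f w v‖ ≤ C * ‖v‖ := by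
  rcases eq_or_ne v 0 with rfl | hv
  · have : mfderiv 𝓘(ℝ, CSpace m) 𝓘(ℝ, CSpace k) f w (0 : CSpace m) = 0 := map_zero _
    rw [this]; simp
  have hv' : ‖v‖ ≠ 0 := norm_ne_zero_iff.2 hv
  have h1 := h (‖v‖⁻¹ • v) (by rw [norm_smul, norm_inv, norm_norm, inv_mul_cancel₀ hv'])
  have h2 : mfderiv 𝓘(ℝ, CSpace m) 𝓘(ℝ, CSpace k) f w (‖v‖⁻¹ • v) =
    ‖v‖⁻¹ • mfderiv 𝓘(ℝ, CSpace m) 𝓘(ℝ, CSpace k) f w v := map_smul _ _ _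
  rw [h2, hermitianLength, norm_smul, norm_inv, norm_norm, inv_mul_le_iff₀' (by positivity)] at h1
  exact h1

variable [IsManifold 𝓘(ℂ, CSpace k) ω M]
  [IsContinuousRiemannianBundle (CSpace k) (fun p : M ↦ TangentSpace 𝓘(ℝ, CSpace k) p)]

theorem continuous_hermitianLength_mfderiv {f : CSpace m → M}
    (hf : ContMDiff 𝓘(ℝ, CSpace m) 𝓘(ℝ, CSpace k) 1 f) :
    Continuous fun x : CSpace m × CSpace m ↦ hermitianLength (k := k) (f x.1)
      (mfderiv 𝓘(ℝ, CSpace m) 𝓘(ℝ, CSpace k) f x.1 x.2) := by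
  have h1 : Continuous fun x : CSpace m × CSpace m ↦
      (⟨f x.1, mfderiv 𝓘(ℝ, CSpace m) 𝓘(ℝ, CSpace k) f x.1 x.2⟩ :
        TotalSpace (CSpace k) (fun p : M ↦ TangentSpace 𝓘(ℝ, CSpace k) p)) :=
    (hf.continuous_tangentMap le_rfl).comp
      (tangentBundleModelSpaceHomeomorph 𝓘(ℝ, CSpace m)).symm.continuous
  have h2 := (h1.inner_bundle h1).sqrt
  simpa only [← norm_eq_sqrt_real_inner, hermitianLength] using h2

theorem continuous_dilation {f : CSpace m → M}
    (hf : ContMDiff 𝓘(ℝ, CSpace m) 𝓘(ℝ, CSpace k) 1 f) : Continuous (dilation (k := k) f) :=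
  (isCompact_sphere (0 : CSpace m) 1).continuous_sSup
    (f := fun w ξ ↦ hermitianLength (k := k) (f w)
      (mfderiv 𝓘(ℝ, CSpace m) 𝓘(ℝ, CSpace k) f w ξ)) (continuous_hermitianLength_mfderiv hf)

theorem hermitianLength_le_dilation {f : CSpace m → M}
    (hf : ContMDiff 𝓘(ℝ, CSpace m) 𝓘(ℝ, CSpace k) 1 f) (w : CSpace m) {ξ : CSpace m}
    (hξ : ‖ξ‖ = 1) : hermitianLength (k := k) (f w)
      (mfderiv 𝓘(ℝ, CSpace m) 𝓘(ℝ, CSpace k) f w ξ) ≤ dilation (k := k) f w := by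
  refine le_csSup ((isCompact_sphere (0 : CSpace m) 1).bddAbove_image ?_) ⟨ξ, by simpa using hξ, rfl⟩
  exact ((continuous_hermitianLength_mfderiv hf).comp (Continuous.prodMk_right w)).continuousOn

/-- `hne` excludes `m = 0`, where the unit sphere is empty and the supremum takes its default value
0. -/
theorem exists_hermitianLength_eq_dilation {f : CSpace m → M}
    (hf : ContMDiff 𝓘(ℝ, CSpace m) 𝓘(ℝ, CSpace k) 1 f) (w : CSpace m)
    (hne : ∃ ξ : CSpace m, ‖ξ‖ = 1) :
    ∃ ξ : CSpace m, ‖ξ‖ = 1 ∧ hermitianLength (k := k) (f w)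
      (mfderiv 𝓘(ℝ, CSpace m) 𝓘(ℝ, CSpace k) f w ξ) = dilation (k := k) f w := by
  obtain ⟨ξ₀, hξ₀⟩ := hne
  obtain ⟨ξ, hξ, h, -⟩ := (isCompact_sphere (0 : CSpace m) 1).exists_sSup_image_eq_and_ge
    ⟨ξ₀, by simpa using hξ₀⟩
    ((continuous_hermitianLength_mfderiv hf).comp (Continuous.prodMk_right w)).continuousOn
  exact ⟨ξ, by simpa using hξ, h.symm⟩

end Dilation

theorem isWeightedYosida_iff {m k : ℕ} {M : Type*} [TopologicalSpace M] [ChartedSpace (CSpace k) M]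
    [RiemannianBundle (fun p : M ↦ TangentSpace 𝓘(ℝ, CSpace k) p)]
    {φ : ℝ → ℝ} {f : CSpace m → M}
    (hf : MDifferentiable 𝓘(ℂ, CSpace m) 𝓘(ℂ, CSpace k) f) :
    IsWeightedYosida (k := k) φ f ↔ ∃ B R : ℝ, ∀ w ξ : CSpace m, R ≤ ‖w‖ → ‖ξ‖ = 1 →
      φ ‖w‖ * hermitianLength (k := k) (f w)
        (mfderiv 𝓘(ℝ, CSpace m) 𝓘(ℝ, CSpace k) f w ξ) ≤ B := by
  have key (P : CSpace m × CSpace m → Prop) :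
      (∀ᶠ x in comap (fun x : CSpace m × CSpace m ↦ ‖x.1‖) atTop ⊓ 𝓟 {x | ‖x.2‖ = 1}, P x) ↔
        ∃ R : ℝ, ∀ w ξ : CSpace m, R ≤ ‖w‖ → ‖ξ‖ = 1 → P (w, ξ) := by
    rw [eventually_inf_principal, (atTop_basis.comap _).eventually_iff]
    simp
  rw [IsWeightedYosida, and_iff_right hf]
  constructor
  · intro h
    obtain ⟨B, hB, hB'⟩ := exists_between h
    obtain ⟨R, hR⟩ := (key _).1 (eventually_lt_of_limsup_lt hB)
    refine ⟨B.toReal, R, fun w ξ hw hξ ↦ ?_⟩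
    exact (ENNReal.ofReal_le_iff_le_toReal hB'.ne).1 (hR w ξ hw hξ).le
  · rintro ⟨B, R, h⟩
    refine (limsup_le_of_le (a := ENNReal.ofReal B) (by isBoundedDefault) ((key _).2
      ⟨R, fun w ξ hw hξ ↦ ENNReal.ofReal_le_ofReal (h w ξ hw hξ)⟩)).trans_lt ENNReal.ofReal_lt_top

/-! ### Normal families. -/

theorem exists_subseq_tendstoUniformlyOn_of_equicontinuous {X Y : Type*} [TopologicalSpace X]
    [LocallyCompactSpace X] [SigmaCompactSpace X] [EMetricSpace Y] [CompactSpace Y]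
    {g : ℕ → X → Y} (hg : Equicontinuous g) :
    ∃ (σ : ℕ → ℕ) (g₀ : X → Y), StrictMono σ ∧
      ∀ K : Set X, IsCompact K → TendstoUniformlyOn (fun n ↦ g (σ n)) g₀ atTop K := by
  let G : ℕ → C(X, Y) := fun n ↦ ⟨g n, hg.continuous n⟩
  have hcl : IsClosedEmbedding
      (UniformOnFun.ofFun {K : Set X | IsCompact K} ∘ fun h : C(X, Y) ↦ (h : X → Y)) := by
    refine ⟨ContinuousMap.isUniformEmbedding_toUniformOnFunIsCompact.isEmbedding, ?_⟩
    change IsClosed (Set.range (ContinuousMap.toUniformOnFunIsCompact (α := X) (β := Y)))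
    rw [ContinuousMap.range_toUniformOnFunIsCompact]
    exact UniformOnFun.isClosed_setOfPred_continuous CompactlyCoherentSpace.isCoherentWith
  have hc : IsCompact (closure (Set.range G)) := by
    refine ArzelaAscoli.isCompact_closure_of_isClosedEmbedding (𝔖 := {K : Set X | IsCompact K})
      (fun K hK ↦ hK) hcl ?_ fun K hK x hx ↦ ⟨Set.univ, isCompact_univ, by simp⟩
    intro K hK
    refine Equicontinuous.equicontinuousOn ?_ K
    intro x U hU
    filter_upwards [hg x U hU] with y hy
    rintro ⟨_, n, rfl⟩
    exact hy n
  obtain ⟨g₀, -, σ, hσ, hlim⟩ := hc.tendsto_subseq (x := G) fun n ↦ subset_closure ⟨n, rfl⟩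
  exact ⟨σ, g₀, hσ, ContinuousMap.tendsto_iff_forall_isCompact_tendstoUniformlyOn.1 hlim⟩

/-- Near a given point all but finitely many maps share the Lipschitz bound; the remaining ones are
handled by their own continuity. -/
theorem equicontinuous_of_edist_le_on_closedBall {X Y : Type*} [PseudoMetricSpace X]
    [PseudoEMetricSpace Y] (x₀ : X) {g : ℕ → X → Y} (hg : ∀ n, Continuous (g n)) {C : ℝ}
    (h : ∀ n : ℕ, ∀ a ∈ Metric.closedBall x₀ (n : ℝ), ∀ b ∈ Metric.closedBall x₀ (n : ℝ),
      edist (g n a) (g n b) ≤ ENNReal.ofReal (C * dist a b)) : Equicontinuous g := by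
  intro x
  rw [uniformity_basis_edist.equicontinuousAt_iff_right]
  intro ε hε
  obtain ⟨N, hN⟩ := exists_nat_ge (dist x x₀ + 1)
  have h1 : ∀ᶠ y in 𝓝 x, ∀ n ∈ Set.Iio N, edist (g n x) (g n y) < ε := by
    rw [eventually_all_finite (Set.finite_Iio N)]
    intro n _
    have : Tendsto (fun y ↦ edist (g n x) (g n y)) (𝓝 x) (𝓝 (edist (g n x) (g n x))) :=
      tendsto_const_nhds.edist ((hg n).tendsto x)
    rw [edist_self] at this
    exact this.eventually_lt_const hε
  have h2 : ∀ᶠ y in 𝓝 x, ENNReal.ofReal (C * dist x y) < ε := by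
    have : Tendsto (fun y ↦ ENNReal.ofReal (C * dist x y)) (𝓝 x)
        (𝓝 (ENNReal.ofReal (C * dist x x))) :=
      (ENNReal.continuous_ofReal.comp (by fun_prop)).tendsto x
    rw [dist_self, mul_zero, ENNReal.ofReal_zero] at this
    exact this.eventually_lt_const hε
  filter_upwards [h1, h2, Metric.closedBall_mem_nhds x one_pos] with y hy1 hy2 hy3 n
  rcases lt_or_ge n N with hn | hn
  · exact hy1 n hn
  · have hnN : (N : ℝ) ≤ n := by exact_mod_cast hn
    have hy4 : dist y x ≤ 1 := hy3
    refine (h n x ?_ y ?_).trans_lt hy2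
    · rw [Metric.mem_closedBall]; linarith
    · rw [Metric.mem_closedBall]; linarith [dist_triangle y x x₀]

/-! ### Comparison of the metric with the norm in a chart. -/

section Chart

variable {m k : ℕ} {M : Type*} [TopologicalSpace M]
  [ChartedSpace (CSpace k) M] [IsManifold 𝓘(ℂ, CSpace k) ω M]
  [RiemannianBundle (fun p : M ↦ TangentSpace 𝓘(ℝ, CSpace k) p)]
  [IsContinuousRiemannianBundle (CSpace k) (fun p : M ↦ TangentSpace 𝓘(ℝ, CSpace k) p)]

/-- The differential of the chart is the trivialization of the tangent bundle on the fibre, and the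
inverse trivialization has locally bounded norm. -/
theorem eventually_norm_le_mul_norm_mfderiv_extChartAt (p : M) :
    ∃ C : ℝ, ∀ᶠ q in 𝓝 p, ∀ (v : TangentSpace 𝓘(ℝ, CSpace k) q) (w : CSpace k),
      mfderiv 𝓘(ℝ, CSpace k) 𝓘(ℝ, CSpace k) (extChartAt 𝓘(ℝ, CSpace k) p) q v = w →
      ‖v‖ ≤ C * ‖w‖ := by
  obtain ⟨C, hC, h⟩ := eventually_norm_symmL_trivializationAt_lt (CSpace k)
    (fun p : M ↦ TangentSpace 𝓘(ℝ, CSpace k) p) p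
  refine ⟨C, ?_⟩
  filter_upwards [h, chart_source_mem_nhds (CSpace k) p] with q hq hqs v w hvw
  have h1 := TangentBundle.continuousLinearMapAt_trivializationAt (I := 𝓘(ℝ, CSpace k)) hqs
  have h2 := (trivializationAt (CSpace k) (fun p : M ↦ TangentSpace 𝓘(ℝ, CSpace k) p)
    p).symmL_continuousLinearMapAt (R := ℝ) (b := q) (by simpa using hqs) v
  have h3 := (DFunLike.congr_fun h1 v).trans hvw
  rw [← h2]
  exact (ContinuousLinearMap.le_of_opNorm_le _ hq.le _).trans_eq
    (congrArg (fun u : CSpace k ↦ C * ‖u‖) h3)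

/-- `C` depends on `p` alone, so the bound can be used along a whole sequence of rescalings. -/
theorem eventually_hermitianLength_le_mul_norm_deriv (p : M) :
    ∃ C : ℝ, ∀ᶠ q in 𝓝 p, ∀ (f : CSpace m → M) (z ξ : CSpace m) (c : ℝ), f z = q → 0 ≤ c →
      MDifferentiable 𝓘(ℂ, CSpace m) 𝓘(ℂ, CSpace k) f →
      c * hermitianLength (k := k) (f z) (mfderiv 𝓘(ℝ, CSpace m) 𝓘(ℝ, CSpace k) f z ξ) ≤
        C * ‖deriv (extChartAt 𝓘(ℂ, CSpace k) p ∘ fun ζ : ℂ ↦ f (z + ((c : ℂ) * ζ) • ξ)) 0‖ := by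
  obtain ⟨C, hC⟩ := eventually_norm_le_mul_norm_mfderiv_extChartAt (k := k) p
  refine ⟨C, ?_⟩
  filter_upwards [hC, chart_source_mem_nhds (CSpace k) p] with q hq hqs f z ξ c hfz hc hf
  subst hfz
  set e := extChartAt 𝓘(ℂ, CSpace k) p
  have hU : f ⁻¹' (chartAt (CSpace k) p).source ∈ 𝓝 z :=
    ((chartAt (CSpace k) p).open_source.preimage hf.continuous).mem_nhds hqs
  have h1 : HasFDerivAt (e ∘ f) (fderiv ℂ (e ∘ f) z) z :=
    ((hf.differentiableOn_extChartAt_comp p).differentiableAt hU).hasFDerivAt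
  have h2 : HasMFDerivAt 𝓘(ℝ, CSpace m) 𝓘(ℝ, CSpace k) (e ∘ f) z
      ((mfderiv 𝓘(ℝ, CSpace k) 𝓘(ℝ, CSpace k) (extChartAt 𝓘(ℝ, CSpace k) p) (f z)).comp
        (mfderiv 𝓘(ℝ, CSpace m) 𝓘(ℝ, CSpace k) f z)) :=
    HasMFDerivAt.comp z (mdifferentiableAt_extChartAt hqs).hasMFDerivAt
      (hf.contMDiff_one_restrictScalars.mdifferentiable one_ne_zero z).hasMFDerivAt
  obtain ⟨D, hD, hDξ⟩ : ∃ D : CSpace m →L[ℝ] CSpace k, HasFDerivAt (e ∘ f) D z ∧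
      mfderiv 𝓘(ℝ, CSpace k) 𝓘(ℝ, CSpace k) (extChartAt 𝓘(ℝ, CSpace k) p) (f z)
        (mfderiv 𝓘(ℝ, CSpace m) 𝓘(ℝ, CSpace k) f z ξ) = D ξ :=
    ⟨_, h2.hasFDerivAt, rfl⟩
  -- The real differential of `e ∘ f` is its complex differential, by uniqueness.
  have h3 := hDξ.trans (DFunLike.congr_fun (hD.unique (h1.restrictScalars ℝ)) ξ)
  have h4 : HasDerivAt (fun ζ : ℂ ↦ z + ((c : ℂ) * ζ) • ξ) ((c : ℂ) • ξ) 0 := by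
    simpa using (((hasDerivAt_id (0 : ℂ)).const_mul (c : ℂ)).smul_const ξ).const_add z
  have h5 : HasDerivAt ((e ∘ f) ∘ fun ζ : ℂ ↦ z + ((c : ℂ) * ζ) • ξ)
      (fderiv ℂ (e ∘ f) z ((c : ℂ) • ξ)) 0 :=
    HasFDerivAt.comp_hasDerivAt (0 : ℂ) (by simpa using h1) h4
  rw [show (e ∘ fun ζ : ℂ ↦ f (z + ((c : ℂ) * ζ) • ξ)) =
    (e ∘ f) ∘ fun ζ : ℂ ↦ z + ((c : ℂ) * ζ) • ξ from rfl, h5.deriv, map_smul, norm_smul,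
    Complex.norm_real, Real.norm_of_nonneg hc, mul_left_comm]
  exact mul_le_mul_of_nonneg_left (hq _ _ h3) hc

end Chart

/-! ### The two directions of the rescaling criterion. -/

section Rescaling

variable {m k : ℕ} {M : Type*} [EMetricSpace M]
  [ChartedSpace (CSpace k) M] [IsManifold 𝓘(ℂ, CSpace k) ω M]
  [RiemannianBundle (fun p : M ↦ TangentSpace 𝓘(ℝ, CSpace k) p)]

theorem IsYosidaWeight.three_quarters_le {φ : ℝ → ℝ} (hφ : IsYosidaWeight φ) {a b : ℝ}
    (ha : 0 < a) (hb : 0 < b) (h : |b - a| ≤ φ a / 4) : 3 / 4 * φ a ≤ φ b := by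
  have h1 := (abs_le.1 (hφ.abs_sub_le hb ha)).1
  linarith

/-- A limit of rescalings of a weighted Yosida map is constant. -/
theorem eq_of_tendsto_rescaling_of_isWeightedYosida [IsRiemannianManifold 𝓘(ℝ, CSpace k) M]
    {φ : ℝ → ℝ} (hφ : IsYosidaWeight φ) {f : CSpace m → M} (hfY : IsWeightedYosida (k := k) φ f)
    {z ξ : ℕ → CSpace m} {ρ : ℕ → ℝ} {g : ℂ → M} (hz : Tendsto (fun j ↦ ‖z j‖) atTop atTop)
    (hξ : ∀ j, ‖ξ j‖ = 1) (hρ : ∀ j, 0 < ρ j) (hρ0 : Tendsto ρ atTop (𝓝 0))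
    (hlim : ∀ ζ : ℂ, Tendsto (fun j ↦ f (z j + (((ρ j * φ ‖z j‖ : ℝ) : ℂ) * ζ) • ξ j)) atTop
      (𝓝 (g ζ))) (ζ : ℂ) : g ζ = g 0 := by
  have hf := hfY.1
  obtain ⟨B, R, hB⟩ := (isWeightedYosida_iff hf).1 hfY
  have h1 : Tendsto (fun j ↦ ρ j * ‖ζ‖) atTop (𝓝 0) := by simpa using hρ0.mul_const ‖ζ‖
  have h2 : Tendsto (fun j ↦ ENNReal.ofReal (|B| / (3 / 4) * (ρ j * ‖ζ‖))) atTop (𝓝 0) := by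
    have := ENNReal.tendsto_ofReal (h1.const_mul (|B| / (3 / 4)))
    simpa using this
  have h3 := (hlim 0).edist (hlim ζ)
  refine (edist_le_zero.1 (le_of_tendsto_of_tendsto h3 h2 ?_)).symm
  -- On the ball used below `‖w‖ ≥ 3/4 * ‖z j‖ - φ 1 / 4`, so this threshold forces `‖w‖ ≥ R`.
  filter_upwards [h1.eventually_le_const (show (0 : ℝ) < 1 / 4 by norm_num),
    hz.eventually_ge_atTop (2 * (|R| + 1) + φ 1)] with j hj1 hj2
  have hφ1 := hφ.pos 1 zero_le_one
  have hzj : 1 ≤ ‖z j‖ := by linarith [abs_nonneg R]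
  have hφz : 0 < φ ‖z j‖ := hφ.pos _ (norm_nonneg _)
  have hc : 0 < ρ j * φ ‖z j‖ := mul_pos (hρ j) hφz
  have hr : ρ j * φ ‖z j‖ * ‖ζ‖ ≤ φ ‖z j‖ / 4 := by nlinarith
  have hw : ∀ w ∈ Metric.closedBall (z j) (ρ j * φ ‖z j‖ * ‖ζ‖), ∀ v : CSpace m,
      ‖mfderiv 𝓘(ℝ, CSpace m) 𝓘(ℝ, CSpace k) f w v‖ ≤ |B| / (3 / 4 * φ ‖z j‖) * ‖v‖ := by
    intro w hw
    rw [mem_closedBall_iff_norm] at hw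
    have h4 : |‖w‖ - ‖z j‖| ≤ φ ‖z j‖ / 4 := (abs_norm_sub_norm_le _ _).trans (hw.trans hr)
    have h5 := hφ.le_add hzj
    have h6 := (abs_le.1 h4).1
    have hwpos : 0 < ‖w‖ := by linarith [abs_nonneg R]
    have h7 := hφ.three_quarters_le (zero_lt_one.trans_le hzj) hwpos h4
    refine norm_mfderiv_le_of_unit fun η hη ↦ ?_
    have h8 := hB w η (by linarith [le_abs_self R]) hη
    rw [le_div_iff₀ (by positivity), mul_comm]
    refine (mul_le_mul_of_nonneg_right h7 ?_).trans (h8.trans (le_abs_self B))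
    exact norm_nonneg (E := TangentSpace 𝓘(ℝ, CSpace k) (f w)) _
  refine (edist_le_of_norm_mfderiv_le hf.contMDiff_one_restrictScalars
    (convex_closedBall (z j) (ρ j * φ ‖z j‖ * ‖ζ‖)) hw ?_ ?_).trans_eq ?_
  · simp only [mul_zero, zero_smul, add_zero]
    exact Metric.mem_closedBall_self (by positivity)
  · rw [mem_closedBall_iff_norm, add_sub_cancel_left, norm_smul, norm_mul, hξ, mul_one,
      Complex.norm_real, Real.norm_of_nonneg hc.le]
  · rw [mul_zero, zero_smul, add_zero, add_sub_cancel_left, norm_smul, norm_mul, hξ, mul_one,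
      Complex.norm_real, Real.norm_of_nonneg hc.le]
    congr 1
    field_simp

variable [IsContinuousRiemannianBundle (CSpace k) (fun p : M ↦ TangentSpace 𝓘(ℝ, CSpace k) p)]

theorem exists_dilation_le_two_mul_of_not_isWeightedYosida {φ : ℝ → ℝ} (hφ : IsYosidaWeight φ)
    {f : CSpace m → M} (hf : MDifferentiable 𝓘(ℂ, CSpace m) 𝓘(ℂ, CSpace k) f)
    (hfY : ¬ IsWeightedYosida (k := k) φ f) (n : ℕ) :
    ∃ (z ξ : CSpace m) (r : ℝ), (n : ℝ) ≤ ‖z‖ ∧ ‖ξ‖ = 1 ∧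
      hermitianLength (k := k) (f z) (mfderiv 𝓘(ℝ, CSpace m) 𝓘(ℝ, CSpace k) f z ξ) =
        dilation (k := k) f z ∧
      (n : ℝ) + 2 ≤ φ ‖z‖ * dilation (k := k) f z ∧ (n : ℝ) ≤ r * dilation (k := k) f z ∧
      ∀ y, dist z y ≤ r → dilation (k := k) f y ≤ 2 * dilation (k := k) f z := by
  have hf1 := hf.contMDiff_one_restrictScalars
  rw [isWeightedYosida_iff hf] at hfY
  push Not at hfY
  -- The factor 8 offsets the radius `φ ‖w‖ / 8` in Hofer's lemma, which moves `w` by at most `φ ‖w‖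
  -- / 4`; the second constant keeps `‖z‖ ≥ n` after that move.
  obtain ⟨w, η, hw, hη, hB⟩ := hfY (8 * (n + 2)) (2 * n + φ 1 + 2)
  have hφ1 := hφ.pos 1 zero_le_one
  have hn : (0 : ℝ) ≤ n := n.cast_nonneg
  have hφw : 0 < φ ‖w‖ := hφ.pos _ (norm_nonneg _)
  have hw1 : 1 ≤ ‖w‖ := by linarith
  have hB' : 8 * ((n : ℝ) + 2) < φ ‖w‖ * dilation (k := k) f w :=
    hB.trans_le (mul_le_mul_of_nonneg_left (hermitianLength_le_dilation hf1 w hη) hφw.le)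
  obtain ⟨r, hr, z, hr1, hzw, hr2, hmax⟩ := hofer w (φ ‖w‖ / 8) (by positivity)
    (continuous_dilation hf1) (dilation_nonneg (k := k) f)
  have h1 : |‖z‖ - ‖w‖| ≤ φ ‖w‖ / 4 := by
    rw [dist_eq_norm] at hzw
    linarith [abs_norm_sub_norm_le z w]
  have h2 := hφ.le_add hw1
  have h3 := (abs_le.1 h1).1
  have h4 : (n : ℝ) ≤ ‖z‖ ∧ 0 < ‖z‖ := ⟨by linarith, by linarith⟩
  have h5 := hφ.three_quarters_le (zero_lt_one.trans_le hw1) h4.2 h1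
  have hz0 := dilation_nonneg (k := k) f z
  have h6 : dilation (k := k) f w ≤ dilation (k := k) f z := by
    refine le_of_mul_le_mul_left (hr2.trans ?_) (show 0 < φ ‖w‖ / 8 by positivity)
    exact mul_le_mul_of_nonneg_right hr1 hz0
  obtain ⟨ξ, hξ, hξz⟩ := exists_hermitianLength_eq_dilation hf1 z ⟨η, hη⟩
  refine ⟨z, ξ, r, h4.1, hξ, hξz, ?_, by linarith, hmax⟩
  have h7 := mul_le_mul_of_nonneg_left h6 hφw.le
  have h8 := mul_le_mul_of_nonneg_right h5 hz0
  linarith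

theorem exists_rescaling_limit_of_not_isWeightedYosida [CompactSpace M]
    [IsRiemannianManifold 𝓘(ℝ, CSpace k) M] {φ : ℝ → ℝ} (hφ : IsYosidaWeight φ)
    {f : CSpace m → M} (hf : MDifferentiable 𝓘(ℂ, CSpace m) 𝓘(ℂ, CSpace k) f)
    (hfY : ¬ IsWeightedYosida (k := k) φ f) :
    ∃ (z ξ : ℕ → CSpace m) (ρ : ℕ → ℝ) (g : ℂ → M),
      Tendsto (fun j ↦ ‖z j‖) atTop atTop ∧ (∀ j, ‖ξ j‖ = 1) ∧
      (∀ j, ρ j ∈ Set.Ioo (0 : ℝ) 1) ∧ Tendsto ρ atTop (𝓝 0) ∧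
      MDifferentiable 𝓘(ℂ, ℂ) 𝓘(ℂ, CSpace k) g ∧ (¬ ∃ c : M, ∀ ζ : ℂ, g ζ = c) ∧
      ∀ K : Set ℂ, IsCompact K → TendstoUniformlyOn
        (fun (j : ℕ) (ζ : ℂ) ↦ f (z j + (((ρ j * φ ‖z j‖ : ℝ) : ℂ) * ζ) • ξ j)) g atTop K := by
  have hf1 := hf.contMDiff_one_restrictScalars
  choose z ξ r hz hξ hξz hφz hr hmax using
    exists_dilation_le_two_mul_of_not_isWeightedYosida hφ hf hfY
  set F : CSpace m → ℝ := dilation (k := k) f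
  have hφpos : ∀ n, 0 < φ ‖z n‖ := fun n ↦ hφ.pos _ (norm_nonneg _)
  have hFpos : ∀ n, 0 < F (z n) := fun n ↦ by
    refine pos_of_mul_pos_right ((?_ : (0 : ℝ) < _).trans_le (hφz n)) (hφpos n).le
    positivity
  -- Chosen so that the total scaling factor `ρ n * φ ‖z n‖` is `(F (z n))⁻¹`.
  set ρ : ℕ → ℝ := fun n ↦ (φ ‖z n‖ * F (z n))⁻¹ with hρ
  have hρφ : ∀ n, ρ n * φ ‖z n‖ = (F (z n))⁻¹ := fun n ↦ by
    have := (hφpos n).ne'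
    have := (hFpos n).ne'
    simp only [hρ]
    field_simp
  have hρpos : ∀ n, 0 < ρ n := fun n ↦ inv_pos.2 (mul_pos (hφpos n) (hFpos n))
  have hρle : ∀ n, ρ n ≤ ((n : ℝ) + 2)⁻¹ := fun n ↦ inv_anti₀ (by positivity) (hφz n)
  have hρ1 : ∀ n, ρ n < 1 := fun n ↦ (hρle n).trans_lt (inv_lt_one_of_one_lt₀ (by
    linarith [n.cast_nonneg (α := ℝ)]))
  have hρ0 : Tendsto ρ atTop (𝓝 0) := by
    refine squeeze_zero (fun n ↦ (hρpos n).le) hρle (tendsto_inv_atTop_zero.comp ?_)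
    exact tendsto_atTop_add_const_right _ _ tendsto_natCast_atTop_atTop
  have hzlim : Tendsto (fun n ↦ ‖z n‖) atTop atTop :=
    tendsto_atTop_mono hz tendsto_natCast_atTop_atTop
  let G : ℕ → ℂ → M := fun n ζ ↦ f (z n + (((ρ n * φ ‖z n‖ : ℝ) : ℂ) * ζ) • ξ n)
  have hG : ∀ n, MDifferentiable 𝓘(ℂ, ℂ) 𝓘(ℂ, CSpace k) (G n) := fun n ↦ by
    have : Differentiable ℂ fun ζ : ℂ ↦ z n + (((ρ n * φ ‖z n‖ : ℝ) : ℂ) * ζ) • ξ n := by fun_prop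
    exact hf.comp this.mdifferentiable
  have hnorm : ∀ n (a : ℂ), ‖(((ρ n * φ ‖z n‖ : ℝ) : ℂ) * a) • ξ n‖ = (F (z n))⁻¹ * ‖a‖ := by
    intro n a
    rw [norm_smul, norm_mul, hξ, mul_one, hρφ, Complex.norm_real,
      Real.norm_of_nonneg (inv_pos.2 (hFpos n)).le]
  have hGlip : ∀ n : ℕ, ∀ a ∈ Metric.closedBall (0 : ℂ) n, ∀ b ∈ Metric.closedBall (0 : ℂ) n,
      edist (G n a) (G n b) ≤ ENNReal.ofReal (2 * dist a b) := by
    intro n a ha b hb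
    have hmem : ∀ c ∈ Metric.closedBall (0 : ℂ) n,
        z n + (((ρ n * φ ‖z n‖ : ℝ) : ℂ) * c) • ξ n ∈ Metric.closedBall (z n) (r n) := by
      intro c hc
      rw [mem_closedBall_iff_norm, add_sub_cancel_left, hnorm, inv_mul_le_iff₀' (hFpos n)]
      exact (mem_closedBall_zero_iff.1 hc).trans (hr n)
    refine (edist_le_of_norm_mfderiv_le hf1 (convex_closedBall (z n) (r n))
      (C := 2 * F (z n)) (fun w hw ↦ norm_mfderiv_le_of_unit fun η hη ↦
        (hermitianLength_le_dilation hf1 w hη).trans (hmax n w ?_))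
      (hmem a ha) (hmem b hb)).trans_eq ?_
    · rw [dist_comm]; exact hw
    · rw [add_sub_add_left_eq_sub, ← sub_smul, ← mul_sub, hnorm, dist_comm, dist_eq_norm]
      have := (hFpos n).ne'
      congr 1
      field_simp
  obtain ⟨σ, g, hσ, hlim⟩ := exists_subseq_tendstoUniformlyOn_of_equicontinuous
    (equicontinuous_of_edist_le_on_closedBall 0 (fun n ↦ (hG n).continuous) hGlip)
  have hg := mdifferentiable_and_tendsto_deriv_of_tendstoUniformlyOn (fun n ↦ hG (σ n)) hlim
  refine ⟨z ∘ σ, ξ ∘ σ, ρ ∘ σ, g, hzlim.comp hσ.tendsto_atTop, fun n ↦ hξ _,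
    fun n ↦ ⟨hρpos _, hρ1 _⟩, hρ0.comp hσ.tendsto_atTop, fun ζ ↦ (hg ζ).1, ?_, hlim⟩
  rintro ⟨c, hc⟩
  have hderiv := (hg 0).2.norm
  rw [show (extChartAt 𝓘(ℂ, CSpace k) (g 0) ∘ g) = fun _ ↦ extChartAt 𝓘(ℂ, CSpace k) (g 0) c from
    funext fun ζ ↦ by simp [hc ζ], deriv_const, norm_zero] at hderiv
  obtain ⟨C, hC⟩ := eventually_hermitianLength_le_mul_norm_deriv (m := m) (k := k) (g 0)
  have h0 : Tendsto (fun n ↦ f (z (σ n))) atTop (𝓝 (g 0)) := by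
    simpa [G] using (hlim {0} isCompact_singleton).tendsto_at rfl
  -- Each rescaled differential at 0 has length exactly 1, while a constant limit would force the
  -- chart derivatives to tend to 0.
  have hle : (1 : ℝ) ≤ C * 0 := by
    refine ge_of_tendsto (hderiv.const_mul C) ?_
    filter_upwards [h0.eventually hC] with n hn
    have := hn f (z (σ n)) (ξ (σ n)) (ρ (σ n) * φ ‖z (σ n)‖) rfl
      (mul_pos (hρpos _) (hφpos _)).le hf
    rw [hξz, hρφ, inv_mul_cancel₀ (hFpos _).ne'] at this
    rw [← hρφ] at this
    exact this
  linarith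

end Rescaling

theorem mainTheorem1 {m k : ℕ} {M : Type*} [EMetricSpace M] [CompactSpace M]
    [ChartedSpace (CSpace k) M] [IsManifold 𝓘(ℂ, CSpace k) ω M]
    [RiemannianBundle (fun p : M ↦ TangentSpace 𝓘(ℝ, CSpace k) p)]
    [IsContMDiffRiemannianBundle 𝓘(ℝ, CSpace k) ∞ (CSpace k)
      (fun p : M ↦ TangentSpace 𝓘(ℝ, CSpace k) p)]
    [IsRiemannianManifold 𝓘(ℝ, CSpace k) M]
    [IsHermitianMetric k M]
    (φ : ℝ → ℝ) (hφ : IsYosidaWeight φ)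
    (f : CSpace m → M) (hf : MDifferentiable 𝓘(ℂ, CSpace m) 𝓘(ℂ, CSpace k) f) :
    ¬ IsWeightedYosida (k := k) φ f ↔
      ∃ (z ξ : ℕ → CSpace m) (ρ : ℕ → ℝ) (g : ℂ → M),
        Tendsto (fun j ↦ ‖z j‖) atTop atTop ∧
        (∀ j, ‖ξ j‖ = 1) ∧
        (∀ j, ρ j ∈ Set.Ioo (0 : ℝ) 1) ∧
        Tendsto ρ atTop (𝓝 0) ∧
        MDifferentiable 𝓘(ℂ, ℂ) 𝓘(ℂ, CSpace k) g ∧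
        (¬ ∃ c : M, ∀ ζ : ℂ, g ζ = c) ∧
        ∀ K : Set ℂ, IsCompact K →
          TendstoUniformlyOn
            (fun (j : ℕ) (ζ : ℂ) ↦ f (z j + (((ρ j * φ ‖z j‖ : ℝ) : ℂ) * ζ) • ξ j))
            g atTop K := by
  have : IsContinuousRiemannianBundle (CSpace k) (fun p : M ↦ TangentSpace 𝓘(ℝ, CSpace k) p) :=
    IsContMDiffRiemannianBundle.isContinuousRiemannianBundle (n := ∞)
  refine ⟨exists_rescaling_limit_of_not_isWeightedYosida hφ hf, ?_⟩
  rintro ⟨z, ξ, ρ, g, hz, hξ, hρ, hρ0, -, hgc, hlim⟩ hfY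
  exact hgc ⟨g 0, eq_of_tendsto_rescaling_of_isWeightedYosida hφ hfY hz hξ (fun j ↦ (hρ j).1) hρ0
    fun ζ ↦ (hlim {ζ} isCompact_singleton).tendsto_at rfl⟩
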